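/- Let $m\ge 2$, let $d_1,\dots,d_m\ge 1$, and consider $m$ subsystems $A_1,\dots,A_m$ with Hilbert space $\mathcal H=\bigotimes_{k=1}^m\mathbb C^{d_k}$. Let $\mathcal E=\{\eta_i,\rho_i\}_{i=0}^{1}$ be a two-state ensemble on $\mathcal H$: $\eta_0,\eta_1\ge 0$, $\eta_0+\eta_1=1$, and $\rho_0,\rho_1$ are density operators on $\mathcal H$. Suppose that for every bipartition $\mathsf X$ of $\{A_1,\dots,A_m\}$ (a partition into two nonempty blocks) $$\eta_0\Gamma_{\mathsf X}(\rho_0)-\eta_1\Gamma_{\mathsf X}(\rho_1)\succeq 0,$$ where $\Gamma_{\mathsf X}$ is the partial transposition of the subsystems in one block of $\mathsf X$ (with respect to the product basis; the condition does not depend on which of the two blocks is transposed). For a positive integer $L$ let $\mathcal E^{(L)}=\{\eta_i^{(L)},\rho_i^{(L)}\}_{i=0}^{1}$, where $$\eta_i^{(L)}=\sum_{c}\ \prod_{l=1}^L\eta_{c_l},\qquad \rho_i^{(L)}=\frac1{\eta_i^{(L)}}\sum_{c}\ \Big(\prod_{l=1}^L\eta_{c_l}\Big)\bigotimes_{l=1}^L\rho_{c_l},$$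 both sums running over all $c\in\{0,1\}^L$ with $c_1+\dots+c_L\equiv i \pmod 2$ (if $\eta_i^{(L)}=0$, the choice of $\rho_i^{(L)}$ is irrelevant). It is regarded as an ensemble of $m$-party states in which party $A_k$ holds the $k$-th subsystems of all $L$ copies. For a partition $\mathsf X$ of $\{A_1,\dots,A_m\}$ let $$p_{\mathsf X}(\mathcal E^{(L)})=\max_{\{M_0,M_1\}}\ \sum_{i=0}^{1}\eta_i^{(L)}\,\mathrm{Tr}\big(\rho_i^{(L)}M_i\big),$$ the maximum being over the two-outcome measurements that can be realized by local operations and classical communication (LOCC) among the blocks of $\mathsf X$, each block acting as a single party; protocols with finitely many rounds and limits of successively extended such protocols (infinitely many rounds) are allowed. Then for every positive integer $L$ and every nontrivial partition $\mathsf X$ of $\{A_1,\dots,A_m\}$ (at least two blocks), this maximum is attained and $$p_{\mathsf X}(\mathcal E^{(L)})=\eta_0^{(L)}.$$ -/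

import Mathlib

open scoped Matrix ComplexOrder

namespace DataHiding

/-- Basis labels of the composite system whose `k`-th subsystem has orthonormal basis `ι k`;
the Hilbert space is `⨂ k, ℂ^(ι k)`. -/
abbrev Idx {m : ℕ} (ι : Fin m → Type) : Type := ∀ k, ι k

/-- Operators on `⨂ k, ℂ^(ι k)`, as matrices in the product basis. -/
abbrev Op {m : ℕ} (ι : Fin m → Type) : Type := Matrix (Idx ι) (Idx ι) ℂ

/-- Partitions of the set of the `m` subsystems (into nonempty, disjoint blocks). -/
abbrev Partition (m : ℕ) : Type := Finpartition (Finset.univ : Finset (Fin m))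

section Ensembles

/-- A family of weights and operators, the raw data of an ensemble `{η i, ρ i}`. -/
structure Ensemble {m : ℕ} (ι : Fin m → Type) (n : ℕ) where
  η : Fin n → ℝ
  ρ : Fin n → Op ι

variable {m n : ℕ} {ι : Fin m → Type} [∀ k, Fintype (ι k)]

/-- The weights form a probability vector and the operators are density operators. -/
structure Ensemble.IsStateEnsemble (E : Ensemble ι n) : Prop where
  prob_nonneg : ∀ i, 0 ≤ E.η i
  prob_sum : ∑ i, E.η i = 1
  state_pos : ∀ i, (E.ρ i).PosSemidef
  state_trace : ∀ i, (E.ρ i).trace = 1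

/-- The average probability `∑ i, η i * Tr (ρ i * M i)` of a correct guess. -/
noncomputable def Ensemble.success (E : Ensemble ι n) (M : Fin n → Op ι) : ℝ :=
  ∑ i, E.η i * (E.ρ i * M i).trace.re

end Ensembles

section MultiFold

variable {m n : ℕ} {ι : Fin m → Type}

/-- In the `L`-fold system the `k`-th party holds `L` copies of its subsystem. -/
abbrev Copies (L : ℕ) (ι : Fin m → Type) : Fin m → Type := fun k => Fin L → ι k

/-- `η_c = ∏ l, η (c l)`. -/
noncomputable def Ensemble.foldWeight (E : Ensemble ι n) (L : ℕ) (c : Fin L → Fin n) : ℝ :=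
  ∏ l, E.η (c l)

/-- `ρ_c = ⨂ l, ρ (c l)`, as an operator on the system in which party `k` holds the `k`-th
subsystems of all `L` copies. -/
noncomputable def Ensemble.foldState (E : Ensemble ι n) (L : ℕ) (c : Fin L → Fin n) :
    Op (Copies L ι) :=
  fun x y => ∏ l, E.ρ (c l) (fun k => x k l) (fun k => y k l)

/-- The vectors `c` of length `L` over `{0, …, n-1}` with entry sum `i` modulo `n`. -/
def sumVectors (n L : ℕ) (i : Fin n) : Finset (Fin L → Fin n) :=
  Finset.univ.filter fun c => (∑ l, (c l : ℕ)) % n = (i : ℕ)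

/-- The ensemble `E^(L)`: the state of index `i` is the normalized mixture of the `ρ_c` over all
`c` with entry sum `i` modulo `n`, its weight the total weight of these `c`.
(Where that weight is `0` the operator is set to `0`.) -/
noncomputable def Ensemble.multiFold (E : Ensemble ι n) (L : ℕ) :
    Ensemble (Copies L ι) n where
  η i := ∑ c ∈ sumVectors n L i, E.foldWeight L c
  ρ i := ((∑ c ∈ sumVectors n L i, E.foldWeight L c : ℝ) : ℂ)⁻¹ •
    ∑ c ∈ sumVectors n L i, (E.foldWeight L c : ℂ) • E.foldState L c

end MultiFold

section PartialTranspose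

variable {m : ℕ} {ι : Fin m → Type}

/-- Partial transposition of the subsystems in `S`. -/
def partialTranspose (S : Finset (Fin m)) (A : Op ι) : Op ι :=
  fun x y => A (fun k => if k ∈ S then y k else x k) (fun k => if k ∈ S then x k else y k)

/-- Transposing the complementary subsystems instead amounts to a further full transposition. -/
theorem partialTranspose_compl (S : Finset (Fin m)) (A : Op ι) :
    partialTranspose Sᶜ A = (partialTranspose S A)ᵀ := by
  ext x y
  simp only [partialTranspose, Matrix.transpose_apply, Finset.mem_compl, ite_not]

/-- `η₀ Γ_X(ρ₀) - η_i Γ_X(ρ_i) ⪰ 0` for `i ≠ 0`, where `Γ_X` transposes one of the two blocks of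
the bipartition `X`. Which block is immaterial: by `partialTranspose_compl` the two choices differ
by a full transposition, which preserves positive semidefiniteness. -/
def Ensemble.PTCondition {n : ℕ} [NeZero n] (E : Ensemble ι n) (X : Partition m) : Prop :=
  ∃ S ∈ X.parts, ∀ i : Fin n, i ≠ 0 →
    ((E.η 0 : ℂ) • partialTranspose S (E.ρ 0) -
      (E.η i : ℂ) • partialTranspose S (E.ρ i)).PosSemidef

end PartialTranspose

section LOCC

/-- A linear operator from `ℂ^β` to some finite-dimensional space `ℂ^out`. -/
structure LocalOp (β : Type) where
  out : Type
  [fin : Fintype out]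
  [dec : DecidableEq out]
  mat : Matrix out β ℂ

attribute [instance] LocalOp.fin LocalOp.dec

/-- The composition `K ∘ A`. -/
def LocalOp.comp {β : Type} (A : LocalOp β) (K : LocalOp A.out) : LocalOp β where
  out := K.out
  mat := K.mat * A.mat

/-- `A† A`. -/
noncomputable def LocalOp.gram {β : Type} (A : LocalOp β) : Matrix β β ℂ := A.matᴴ * A.mat

variable {m : ℕ} (ι : Fin m → Type) [∀ k, Fintype (ι k)] [∀ k, DecidableEq (ι k)]

/-- Basis labels of the joint system of a block `S`, which acts as a single party. -/
abbrev BlockIdx (S : Finset (Fin m)) : Type := ∀ k : S, ι k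

/-- A branch of an LOCC protocol among the blocks of `X` (one sequence of measurement outcomes),
recorded by the operator that each block has applied to its system along that branch. -/
abbrev Branch (X : Partition m) : Type 1 := ∀ p : X.parts, LocalOp (BlockIdx ι p.1)

/-- The branch before anything is done: every block has applied the identity. -/
def Branch.start (X : Partition m) : Branch ι X := fun p => { out := BlockIdx ι p.1, mat := 1 }

variable {ι}

/-- The POVM element `⨂ p, A_p† A_p` of a branch, as an operator on the whole system. -/
noncomputable def Branch.effect {X : Partition m} (a : Branch ι X) : Op ι :=
  fun x y => ∏ p : X.parts, (a p).gram (fun k => x k) (fun k => y k)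

/-- One step of an LOCC protocol, on the collection of its current branches: in one branch `a`
some block `p` performs a local measurement with Kraus operators `K j` (ancillas and changes of
dimension are allowed) and announces the outcome, so that `a` splits into one branch per outcome.
Party and measurement may depend on the branch, that is, on all earlier outcomes. Coarser local
instruments and shared randomness are covered, since later steps may disregard outcomes. -/
inductive LOCCStep {X : Partition m} : Multiset (Branch ι X) → Multiset (Branch ι X) → Prop
  | measure (rest : Multiset (Branch ι X)) (a : Branch ι X) (p : X.parts) (o : ℕ)
      (K : Fin o → LocalOp (a p).out) (hK : ∑ j, (K j).gram = 1) :
      LOCCStep (a ::ₘ rest)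
        ((Finset.univ : Finset (Fin o)).val.map
          (fun j => Function.update a p ((a p).comp (K j))) + rest)

/-- `t` arises from `s` by finitely many LOCC steps. -/
def LOCCExtends {X : Partition m} (s t : Multiset (Branch ι X)) : Prop :=
  Relation.ReflTransGen LOCCStep s t

/-- The `n`-outcome measurements realizable by LOCC among the blocks of `X`. After stage `ν` of
the protocol, `B ν i` is the collection of the branches for which the outcome `i` would be
reported; every stage continues the previous one by finitely many LOCC steps, and the reported
measurements converge to `M`. A constant `B` gives the protocols with finitely many rounds,
a general `B` those with infinitely many rounds. -/
def LOCCMeasurements (n : ℕ) (X : Partition m) : Set (Fin n → Op ι) :=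
  {M | ∃ B : ℕ → Fin n → Multiset (Branch ι X),
    LOCCExtends {Branch.start ι X} (∑ i, B 0 i) ∧
    (∀ ν, LOCCExtends (∑ i, B ν i) (∑ i, B (ν + 1) i)) ∧
    ∀ i, Filter.Tendsto (fun ν => ((B ν i).map Branch.effect).sum) Filter.atTop (nhds (M i))}

/-- The success probabilities that LOCC measurements among the blocks of `X` achieve. -/
def Ensemble.successValues {n : ℕ} (X : Partition m) (E : Ensemble ι n) : Set ℝ :=
  E.success '' LOCCMeasurements n X

/-- The optimal success probability `p_X(E)`. -/
noncomputable def Ensemble.pLOCC {n : ℕ} (X : Partition m) (E : Ensemble ι n) : ℝ :=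
  sSup (E.successValues X)

end LOCC

end DataHiding

/-! Write `σ i` for the unnormalized mixture `E.foldMixture L i`. Separating the `c` by parity with
signs gives `σ 0 - σ 1` as the `L`-th tensor power of `η₀ρ₀ - η₁ρ₁` (`Ensemble.foldMixture_sub`).
Partial transposition commutes with this power, so the hypothesis, applied to a bipartition coarser
than `X`, makes the partial transpose of `σ 0 - σ 1` positive semidefinite. An LOCC effect is a
limit of sums of products of positive operators on the blocks, and such products stay positive under
the same partial transposition (`Branch.posSemidef_partialTranspose_effect`). Transposing both
factors preserves the trace pairing (`trace_partialTranspose_mul`), so `Tr ((σ 0 - σ 1) M₁) ≥ 0`. As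
`M₀ + M₁ = 1`, the success probability is `Tr σ 0 - Tr ((σ 0 - σ 1) M₁) ≤ Tr σ 0 = η₀^(L)`, with
equality for the constant guess `0`. -/

namespace Matrix.PosSemidef

variable {α : Type*} [Fintype α]

/-- Schur product theorem for finitely many factors. -/
theorem prod_entries {κ : Type*} (s : Finset κ) {G : κ → Matrix α α ℂ}
    (hG : ∀ p ∈ s, (G p).PosSemidef) :
    (Matrix.of fun x y => ∏ p ∈ s, G p x y).PosSemidef := by
  classical
  induction s using Finset.induction_on with
  | empty =>
    have h := Matrix.posSemidef_vecMulVec_star_self (R := ℂ) (fun _ : α => 1)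
    convert h using 1
    ext x y
    simp [Matrix.vecMulVec]
  | insert p s hp ih =>
    have h := (hG p (Finset.mem_insert_self p s)).hadamard
      (ih fun q hq => hG q (Finset.mem_insert_of_mem hq))
    have heq : (Matrix.of fun x y => ∏ q ∈ insert p s, G q x y) =
        G p ⊙ Matrix.of fun x y => ∏ q ∈ s, G q x y := by
      ext x y
      simp [Finset.prod_insert hp]
    rw [heq]
    exact h

/-- The Hilbert–Schmidt product of positive semidefinite matrices is nonnegative. -/
theorem trace_mul_nonneg {A B : Matrix α α ℂ} (hA : A.PosSemidef) (hB : B.PosSemidef) :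
    0 ≤ (A * B).trace := by
  -- The trace is the quadratic form of the Hadamard product `A ⊙ Bᵀ` at the all-ones vector.
  have h := (hA.hadamard hB.transpose).dotProduct_mulVec_nonneg (fun _ => 1)
  convert h using 1
  simp [Matrix.trace, Matrix.mul_apply, dotProduct, Matrix.mulVec]

end Matrix.PosSemidef

namespace DataHiding

/-! ### Partial transposition: trace pairing and tensor powers -/

section PartialTranspose

variable {m : ℕ} {ι : Fin m → Type}

/-- Exchanging the coordinates in `S` of a pair of basis labels. -/
def swapOn (S : Finset (Fin m)) : Idx ι × Idx ι ≃ Idx ι × Idx ι :=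
  Function.Involutive.toPerm
    (fun z => (fun k => if k ∈ S then z.2 k else z.1 k, fun k => if k ∈ S then z.1 k else z.2 k))
    (fun z => by
      refine Prod.ext (funext fun k => ?_) (funext fun k => ?_) <;> by_cases h : k ∈ S <;> simp [h])

/-- The trace sums `A x y * B y x` over all pairs `(x, y)`; transposing both factors only permutes
these pairs by `swapOn S`. -/
theorem trace_partialTranspose_mul [∀ k, Fintype (ι k)] (S : Finset (Fin m)) (A B : Op ι) :
    (partialTranspose S A * partialTranspose S B).trace = (A * B).trace := by
  simp only [Matrix.trace, Matrix.diag, Matrix.mul_apply]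
  rw [← Fintype.sum_prod_type', ← Fintype.sum_prod_type']
  exact Equiv.sum_comp (swapOn S) fun z : Idx ι × Idx ι => A z.1 z.2 * B z.2 z.1

/-- The `L`-fold tensor power, regrouped by parties. -/
def tensorPower (L : ℕ) (A : Op ι) : Op (Copies L ι) :=
  fun x y => ∏ l, A (fun k => x k l) (fun k => y k l)

theorem partialTranspose_tensorPower (S : Finset (Fin m)) (L : ℕ) (A : Op ι) :
    partialTranspose S (tensorPower L A) = tensorPower L (partialTranspose S A) := by
  ext x y
  simp only [partialTranspose, tensorPower]
  refine Finset.prod_congr rfl fun l _ => ?_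
  congr 1 <;> (funext k; split_ifs <;> rfl)

/-- Entrywise, the power is a Schur product of pullbacks of `A` along the projections to the single
copies. -/
theorem posSemidef_tensorPower [∀ k, Fintype (ι k)] (L : ℕ) {A : Op ι} (hA : A.PosSemidef) :
    (tensorPower L A).PosSemidef :=
  Matrix.PosSemidef.prod_entries Finset.univ fun l _ =>
    hA.submatrix fun (x : Idx (Copies L ι)) k => x k l

end PartialTranspose

/-! ### The unnormalized mixtures of the `L`-fold ensemble -/

section MultiFold

variable {m n : ℕ} {ι : Fin m → Type}

/-- `η_i^(L) ρ_i^(L)`, written without normalization. -/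
noncomputable def Ensemble.foldMixture (E : Ensemble ι n) (L : ℕ) (i : Fin n) :
    Op (Copies L ι) :=
  ∑ c ∈ sumVectors n L i, (E.foldWeight L c : ℂ) • E.foldState L c

/-- Holds also at total weight `0`: the weights are nonnegative, so each one vanishes and the
mixture is `0`. -/
theorem Ensemble.multiFold_smul (E : Ensemble ι n) (hη : ∀ i, 0 ≤ E.η i) (L : ℕ) (i : Fin n) :
    ((E.multiFold L).η i : ℂ) • (E.multiFold L).ρ i = E.foldMixture L i := by
  have hw : ∀ c ∈ sumVectors n L i, 0 ≤ E.foldWeight L c := fun c _ =>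
    Finset.prod_nonneg fun l _ => hη _
  change ((∑ c ∈ sumVectors n L i, E.foldWeight L c : ℝ) : ℂ) •
    (((∑ c ∈ sumVectors n L i, E.foldWeight L c : ℝ) : ℂ)⁻¹ • E.foldMixture L i) = _
  by_cases h0 : ∑ c ∈ sumVectors n L i, E.foldWeight L c = 0
  · rw [h0, Complex.ofReal_zero, zero_smul, Ensemble.foldMixture]
    refine (Finset.sum_eq_zero fun c hc => ?_).symm
    rw [(Finset.sum_eq_zero_iff_of_nonneg hw).1 h0 c hc, Complex.ofReal_zero, zero_smul]
  · rw [smul_inv_smul₀ (Complex.ofReal_ne_zero.2 h0)]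

theorem Ensemble.success_multiFold [∀ k, Fintype (ι k)] (E : Ensemble ι n)
    (hη : ∀ i, 0 ≤ E.η i) (L : ℕ) (M : Fin n → Op (Copies L ι)) :
    (E.multiFold L).success M = ∑ i, (E.foldMixture L i * M i).trace.re := by
  refine Finset.sum_congr rfl fun i _ => ?_
  rw [← E.multiFold_smul hη, Matrix.smul_mul, Matrix.trace_smul, smul_eq_mul,
    Complex.re_ofReal_mul]

theorem Ensemble.IsStateEnsemble.trace_foldState [∀ k, Fintype (ι k)] {E : Ensemble ι n}
    (hE : E.IsStateEnsemble) (L : ℕ) (c : Fin L → Fin n) : (E.foldState L c).trace = 1 := by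
  have h : ∏ l, (E.ρ (c l)).trace = 1 := Finset.prod_eq_one fun l _ => hE.state_trace (c l)
  rw [← h]
  simp only [Matrix.trace, Matrix.diag, Finset.prod_univ_sum, Fintype.piFinset_univ]
  exact Equiv.sum_comp (Equiv.piComm fun (k : Fin m) (_ : Fin L) => ι k)
    fun z : Fin L → Idx ι => ∏ l, E.ρ (c l) (z l) (z l)

theorem Ensemble.IsStateEnsemble.trace_foldMixture [∀ k, Fintype (ι k)] {E : Ensemble ι n}
    (hE : E.IsStateEnsemble) (L : ℕ) (i : Fin n) :
    (E.foldMixture L i).trace = ((E.multiFold L).η i : ℂ) := by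
  simp [Ensemble.foldMixture, Ensemble.multiFold, Matrix.trace_sum, hE.trace_foldState]

/-- The signed two-state mixture factorizes over the copies. -/
theorem Ensemble.foldMixture_sub (E : Ensemble ι 2) (L : ℕ) :
    E.foldMixture L 0 - E.foldMixture L 1 =
      tensorPower L ((E.η 0 : ℂ) • E.ρ 0 - (E.η 1 : ℂ) • E.ρ 1) := by
  ext x y
  let f : Fin 2 → Fin L → ℂ := fun i l =>
    (E.η i : ℂ) * E.ρ i (fun k => x k l) (fun k => y k l)
  have hmix : ∀ i, E.foldMixture L i x y = ∑ c ∈ sumVectors 2 L i, ∏ l, f (c l) l := by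
    intro i
    simp [Ensemble.foldMixture, Matrix.sum_apply, Ensemble.foldWeight, Ensemble.foldState, f,
      Finset.prod_mul_distrib]
  -- Expanding the product over the copies, the term of `c` carries the sign `(-1) ^ ∑ c l`, which
  -- is the parity that separates the two mixtures.
  have hpow : tensorPower L ((E.η 0 : ℂ) • E.ρ 0 - (E.η 1 : ℂ) • E.ρ 1) x y =
      ∑ c : Fin L → Fin 2, (-1) ^ (∑ l, (c l : ℕ)) * ∏ l, f (c l) l := by
    have h1 : ∀ l, ((E.η 0 : ℂ) • E.ρ 0 - (E.η 1 : ℂ) • E.ρ 1) (fun k => x k l) (fun k => y k l) =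
        ∑ i : Fin 2, (-1) ^ (i : ℕ) * f i l := fun l => by
      simp [f, Fin.sum_univ_two, sub_eq_add_neg]
    simp only [tensorPower, h1, Finset.prod_univ_sum, Fintype.piFinset_univ,
      Finset.prod_mul_distrib, Finset.prod_pow_eq_pow_sum]
  rw [Matrix.sub_apply, hmix, hmix, hpow, sumVectors, sumVectors, Finset.sum_filter,
    Finset.sum_filter, ← Finset.sum_sub_distrib]
  refine Finset.sum_congr rfl fun c _ => ?_
  rcases Nat.mod_two_eq_zero_or_one (∑ l, (c l : ℕ)) with h | h
  · simp [h, (Nat.even_iff.2 h).neg_one_pow]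
  · simp [h, (Nat.odd_iff.2 h).neg_one_pow]

end MultiFold

/-! ### LOCC effects: completeness and positivity under partial transposition -/

section LOCC

variable {m : ℕ} {ι : Fin m → Type} {X : Partition m}

theorem LocalOp.sum_gram_comp {β : Type} (A : LocalOp β) {o : ℕ} (K : Fin o → LocalOp A.out)
    (hK : ∑ j, (K j).gram = 1) : ∑ j, (A.comp (K j)).gram = A.gram := by
  have h : ∀ j, (A.comp (K j)).gram = A.matᴴ * (K j).gram * A.mat := fun j => by
    change ((K j).mat * A.mat)ᴴ * ((K j).mat * A.mat) = A.matᴴ * ((K j).matᴴ * (K j).mat) * A.mat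
    simp only [Matrix.conjTranspose_mul, Matrix.mul_assoc]
  simp only [h]
  rw [← Matrix.sum_mul, ← Matrix.mul_sum, hK, Matrix.mul_one, LocalOp.gram]

theorem Branch.effect_update (a : Branch ι X) (p : X.parts) (A : LocalOp (BlockIdx ι p.1))
    (x y : Idx ι) :
    (Branch.effect (Function.update a p A)) x y =
      A.gram (fun k => x k) (fun k => y k) *
        ∏ q ∈ Finset.univ.erase p, (a q).gram (fun k => x k) (fun k => y k) := by
  rw [Branch.effect, ← Finset.mul_prod_erase _ _ (Finset.mem_univ p), Function.update_self]
  congr 1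
  refine Finset.prod_congr rfl fun q hq => ?_
  rw [Function.update_of_ne (Finset.ne_of_mem_erase hq)]

/-- Only the factor of block `p` changes, and completeness of the Kraus operators restores it on
summation. Hence the total effect is invariant under LOCC steps. -/
theorem Branch.sum_effect_measure (a : Branch ι X) (p : X.parts) {o : ℕ}
    (K : Fin o → LocalOp (a p).out) (hK : ∑ j, (K j).gram = 1) :
    ∑ j, Branch.effect (Function.update a p ((a p).comp (K j))) = a.effect := by
  ext x y
  rw [Matrix.sum_apply]
  simp only [Branch.effect_update]
  rw [← Finset.sum_mul, ← Matrix.sum_apply, (a p).sum_gram_comp K hK, Branch.effect,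
    ← Finset.mul_prod_erase _ _ (Finset.mem_univ p)]

theorem LOCCStep.sum_effect {s t : Multiset (Branch ι X)} (h : LOCCStep s t) :
    (t.map Branch.effect).sum = (s.map Branch.effect).sum := by
  cases h with
  | measure rest a p o K hK =>
    rw [Multiset.map_add, Multiset.sum_add, Multiset.map_map, Multiset.map_cons,
      Multiset.sum_cons, ← a.sum_effect_measure p K hK]
    rfl

theorem LOCCExtends.sum_effect {s t : Multiset (Branch ι X)} (h : LOCCExtends s t) :
    (t.map Branch.effect).sum = (s.map Branch.effect).sum := by
  induction h with
  | refl => rfl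
  | tail _ hstep ih => rw [hstep.sum_effect, ih]

/-- A union of blocks of `X` is a set that every block is inside of or disjoint from. Transposing
such a set of subsystems keeps product effects positive semidefinite. -/
theorem Branch.posSemidef_partialTranspose_effect [∀ k, Fintype (ι k)] (a : Branch ι X)
    {S : Finset (Fin m)} (hS : ∀ p ∈ X.parts, p ⊆ S ∨ Disjoint p S) :
    (partialTranspose S a.effect).PosSemidef := by
  have hgram : ∀ p, (a p).gram.PosSemidef := fun p =>
    Matrix.posSemidef_conjTranspose_mul_self (a p).mat
  refine Matrix.PosSemidef.prod_entries (G := fun p : X.parts => Matrix.of fun x y : Idx ι =>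
    (a p).gram (fun k => if k.1 ∈ S then y k else x k) (fun k => if k.1 ∈ S then x k else y k))
    Finset.univ fun p _ => ?_
  rcases hS p.1 p.2 with h | h
  · have hmem : ∀ k : p.1, k.1 ∈ S := fun k => h k.2
    simp only [hmem, if_true]
    exact (hgram p).transpose.submatrix fun (x : Idx ι) (k : p.1) => x k
  · have hmem : ∀ k : p.1, k.1 ∉ S := fun k => Finset.disjoint_left.1 h k.2
    simp only [hmem, if_false]
    exact (hgram p).submatrix fun (x : Idx ι) (k : p.1) => x k

variable [∀ k, Fintype (ι k)] [∀ k, DecidableEq (ι k)]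

theorem Branch.effect_start : (Branch.start ι X).effect = 1 := by
  ext x y
  have hgram : ∀ p, (Branch.start ι X p).gram = 1 := fun p => by
    have h : (1 : Matrix (BlockIdx ι p.1) (BlockIdx ι p.1) ℂ)ᴴ * 1 = 1 := by
      rw [Matrix.conjTranspose_one, Matrix.mul_one]
    exact h
  simp only [Branch.effect, hgram]
  by_cases h : x = y
  · subst h
    rw [Matrix.one_apply_eq]
    exact Finset.prod_eq_one fun p _ => Matrix.one_apply_eq _
  · rw [Matrix.one_apply_ne h]
    obtain ⟨k, hk⟩ := Function.ne_iff.1 h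
    obtain ⟨p, hp, hkp⟩ := X.exists_mem (Finset.mem_univ k)
    exact Finset.prod_eq_zero (Finset.mem_univ ⟨p, hp⟩)
      (Matrix.one_apply_ne fun he => hk (congrFun he ⟨k, hkp⟩))

/-- LOCC measurements are complete. -/
theorem sum_eq_one_of_mem_LOCCMeasurements {n : ℕ} {M : Fin n → Op ι}
    (hM : M ∈ LOCCMeasurements n X) : ∑ i, M i = 1 := by
  obtain ⟨B, h0, hs, hlim⟩ := hM
  have hall : ∀ ν, LOCCExtends {Branch.start ι X} (∑ i, B ν i) := fun ν => by
    induction ν with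
    | zero => exact h0
    | succ ν ih => exact Relation.ReflTransGen.trans ih (hs ν)
  have hsum : ∀ ν, ∑ i, ((B ν i).map Branch.effect).sum = 1 := fun ν => by
    have h := (hall ν).sum_effect
    rw [Multiset.map_singleton, Multiset.sum_singleton, Branch.effect_start] at h
    rw [← h]
    exact (map_sum (Multiset.sumAddMonoidHom.comp (Multiset.mapAddMonoidHom Branch.effect))
      (B ν) Finset.univ).symm
  have hlim' := tendsto_finsetSum Finset.univ fun i _ => hlim i
  simp only [hsum] at hlim'
  exact tendsto_nhds_unique hlim' tendsto_const_nhds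

/-- An operator with positive partial transpose has nonnegative expectation in every LOCC effect. -/
theorem trace_mul_nonneg_of_mem_LOCCMeasurements {n : ℕ} {M : Fin n → Op ι}
    (hM : M ∈ LOCCMeasurements n X) {S : Finset (Fin m)}
    (hS : ∀ p ∈ X.parts, p ⊆ S ∨ Disjoint p S) {A : Op ι}
    (hA : (partialTranspose S A).PosSemidef) (i : Fin n) : 0 ≤ (A * M i).trace.re := by
  obtain ⟨B, -, -, hlim⟩ := hM
  have hcont : Continuous fun N : Op ι => (A * N).trace.re :=
    Complex.continuous_re.comp (continuous_const.matrix_mul continuous_id).matrix_trace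
  -- The inequality is closed, so the finite stages suffice, and there it is checked branch by
  -- branch.
  refine ge_of_tendsto' ((hcont.tendsto (M i)).comp (hlim i)) fun ν => ?_
  change 0 ≤ (A * ((B ν i).map Branch.effect).sum).trace.re
  induction B ν i using Multiset.induction_on with
  | empty => simp
  | cons a s ih =>
    rw [Multiset.map_cons, Multiset.sum_cons, mul_add, Matrix.trace_add, Complex.add_re]
    refine add_nonneg ?_ ih
    rw [← trace_partialTranspose_mul S]
    exact (Complex.le_def.1 (hA.trace_mul_nonneg (a.posSemidef_partialTranspose_effect hS))).1

/-- Reporting a fixed outcome without measuring. -/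
theorem single_one_mem_LOCCMeasurements {n : ℕ} (i : Fin n) :
    (Pi.single i 1 : Fin n → Op ι) ∈ LOCCMeasurements n X := by
  refine ⟨fun _ => Pi.single i {Branch.start ι X}, ?_, fun _ => Relation.ReflTransGen.refl, ?_⟩
  · rw [Finset.sum_pi_single' i, if_pos (Finset.mem_univ i)]
    exact Relation.ReflTransGen.refl
  · intro j
    convert tendsto_const_nhds
    by_cases h : j = i
    · subst h
      simp [Branch.effect_start]
    · simp [h]

end LOCC

/-! ### Coarsening a partition to a bipartition -/

section Bipartition

variable {m : ℕ}

/-- The bipartition with blocks `S` and `Sᶜ`. -/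
def bipartition (S : Finset (Fin m)) (hS : S ≠ ∅) (hS' : Sᶜ ≠ ∅) : Partition m :=
  (Finpartition.indiscrete hS).extend hS' disjoint_compl_right sup_compl_eq_top

theorem bipartition_parts (S : Finset (Fin m)) (hS : S ≠ ∅) (hS' : Sᶜ ≠ ∅) :
    (bipartition S hS hS').parts = {Sᶜ, S} := rfl

theorem bipartition_card (S : Finset (Fin m)) (hS : S ≠ ∅) (hS' : Sᶜ ≠ ∅) :
    (bipartition S hS hS').parts.card = 2 := by
  rw [bipartition_parts]
  refine Finset.card_pair fun h => hS ?_
  have hd : Disjoint S Sᶜ := disjoint_compl_right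
  rwa [h, disjoint_self] at hd

/-- A nontrivial partition refines some bipartition. -/
theorem exists_bipartition (X : Partition m) (hX : 2 ≤ X.parts.card) :
    ∃ Y : Partition m, Y.parts.card = 2 ∧
      ∀ S ∈ Y.parts, ∀ p ∈ X.parts, p ⊆ S ∨ Disjoint p S := by
  obtain ⟨S, hS, T, hT, hST⟩ := Finset.one_lt_card.1 hX
  have hdisj : ∀ p ∈ X.parts, p ≠ S → Disjoint p S := fun p hp hne => X.disjoint hp hS hne
  have hcompl : Sᶜ ≠ ∅ := fun h => X.ne_bot hT <| by
    have := hdisj T hT hST.symm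
    rwa [compl_eq_bot.1 h, disjoint_top] at this
  refine ⟨bipartition S (X.ne_bot hS) hcompl, bipartition_card _ _ _, fun R hR p hp => ?_⟩
  rw [bipartition_parts, Finset.mem_insert, Finset.mem_singleton] at hR
  by_cases hpS : p = S
  · subst hpS
    rcases hR with rfl | rfl
    · exact Or.inr disjoint_compl_right
    · exact Or.inl subset_rfl
  · rcases hR with rfl | rfl
    · exact Or.inl (Finset.subset_compl_iff_disjoint_right.2 (hdisj p hp hpS))
    · exact Or.inr (hdisj p hp hpS)

end Bipartition

/-- Guessing `0` is an optimal LOCC strategy for `E^(L)`. -/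
theorem isGreatest_successValues_multiFold {m : ℕ} {ι : Fin m → Type} [∀ k, Fintype (ι k)]
    [∀ k, DecidableEq (ι k)] {E : Ensemble ι 2} (hE : E.IsStateEnsemble)
    (hPT : ∀ X : Partition m, X.parts.card = 2 → E.PTCondition X) (L : ℕ)
    (X : Partition m) (hX : 2 ≤ X.parts.card) :
    IsGreatest ((E.multiFold L).successValues X) ((E.multiFold L).η 0) := by
  constructor
  · refine ⟨Pi.single 0 1, single_one_mem_LOCCMeasurements 0, ?_⟩
    rw [E.success_multiFold hE.prob_nonneg, Fin.sum_univ_two]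
    simp [hE.trace_foldMixture]
  · rintro _ ⟨M, hM, rfl⟩
    obtain ⟨Y, hY, hYX⟩ := exists_bipartition X hX
    obtain ⟨S, hSY, hS⟩ := hPT Y hY
    have hpos : (partialTranspose S (E.foldMixture L 0 - E.foldMixture L 1)).PosSemidef := by
      rw [E.foldMixture_sub, partialTranspose_tensorPower]
      exact posSemidef_tensorPower L (hS 1 one_ne_zero)
    -- Outcome `1` is where guessing `0` instead would gain: this bounds `Tr (σ 1 M₁)` by `Tr (σ 0
    -- M₁)`.
    have hnonneg := trace_mul_nonneg_of_mem_LOCCMeasurements hM (hYX S hSY) hpos 1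
    have hone := sum_eq_one_of_mem_LOCCMeasurements hM
    rw [Fin.sum_univ_two] at hone
    have htot : (E.foldMixture L 0 * M 0).trace.re + (E.foldMixture L 0 * M 1).trace.re =
        (E.multiFold L).η 0 := by
      rw [← Complex.add_re, ← Matrix.trace_add, ← mul_add, hone, mul_one, hE.trace_foldMixture,
        Complex.ofReal_re]
    rw [sub_mul, Matrix.trace_sub, Complex.sub_re] at hnonneg
    rw [E.success_multiFold hE.prob_nonneg, Fin.sum_univ_two]
    linarith

end DataHiding

theorem corollary2 {m : ℕ} (hm : 2 ≤ m) (d : Fin m → ℕ) (hd : ∀ k, 0 < d k)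
    (E : DataHiding.Ensemble (fun k => Fin (d k)) 2) (hE : E.IsStateEnsemble)
    (hPT : ∀ X : DataHiding.Partition m, X.parts.card = 2 → E.PTCondition X)
    (L : ℕ) (hL : 0 < L)
    (X : DataHiding.Partition m) (hX : 2 ≤ X.parts.card) :
    IsGreatest ((E.multiFold L).successValues X) ((E.multiFold L).pLOCC X) ∧
      (E.multiFold L).pLOCC X = (E.multiFold L).η 0 := by
  have h := DataHiding.isGreatest_successValues_multiFold hE hPT L X hX
  have hp : (E.multiFold L).pLOCC X = (E.multiFold L).η 0 := h.csSup_eq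
  exact ⟨hp ▸ h, hp⟩
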